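/- For a root of unity $z\in\mathbb{C}$ and an integer $s\ge 1$ with $(s,z)\neq(1,1)$ put $$\mathrm{Li}_s(z)=\lim_{N\to\infty}\sum_{0<n\le N}\frac{z^n}{n^s},$$ and for roots of unity $x,y\in\mathbb{C}$ and integers $p,s\ge 1$ with $(s,y)\neq(1,1)$ put $$\mathrm{Li}_{p,s}(x,y)=\lim_{N\to\infty}\sum_{0<m<n\le N}\frac{x^m y^n}{m^p n^s}.$$ For a root of unity $z$ and an integer $l\ge 0$ write $S_l(z)=(-1)^l\,\mathrm{Li}_l(1/z)+\mathrm{Li}_l(z)$, with the conventions $S_0(z)=-1$ (that is, $\mathrm{Li}_0(z)+\mathrm{Li}_0(1/z)=-1$) and $S_1(1)=0$ (the two divergent series cancel term by term). Let $x,y$ be roots of unity and let $q,k\ge 1$ be integers with $(q,x)\neq(1,1)$ and $(k,y)\neq(1,1)$. Then the limits defining $\mathrm{Li}_s(z)$ (for every root of unity $z$ and every integer $s\ge1$ with $(s,z)\ne(1,1)$), $\mathrm{Li}_{q,k}(x,y)$ and $\mathrm{Li}_{k,q}(1/y,1/x)$ exist, and $$\begin{aligned} &\mathrm{Li}_{q,k}(x,y)+(-1)^q\,\mathrm{Li}_k(y)\,\mathrm{Li}_q\!\left(\tfrac1x\right)+(-1)^{q+k}\,\mathrm{Li}_{k,q}\!\left(\tfrac1y,\tfrac1x\right)\\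 &\quad-(-1)^q\sum_{l=0}^{k}\binom{q+k-l-1}{q-1}\,S_l(xy)\,\mathrm{Li}_{q+k-l}\!\left(\tfrac1x\right)\\ &\quad-\sum_{\substack{l+m=q\\ l,m\ge 0}}(-1)^m\binom{m+k-1}{k-1}\,S_l(xy)\,\mathrm{Li}_{k+m}(y)=0 . \end{aligned}$$ -/

import Mathlib

open Filter Topology

/-- `z` is a complex root of unity (of some order). -/
def IsUnityRoot (z : ℂ) : Prop := ∃ n : ℕ, 0 < n ∧ z ^ n = 1

/-- Partial sum `∑_{0 < n ≤ N} z ^ n / n ^ k` of the depth-one series. -/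
noncomputable def liPartial (k : ℕ) (z : ℂ) (N : ℕ) : ℂ :=
  ∑ n ∈ Finset.Icc 1 N, z ^ n / (n : ℂ) ^ k

/-- Partial sum `∑_{0 < m < n ≤ N} x ^ m * y ^ n / (m ^ p * n ^ q)` of the depth-two series. -/
noncomputable def liTwoPartial (p q : ℕ) (x y : ℂ) (N : ℕ) : ℂ :=
  ∑ n ∈ Finset.Icc 1 N, ∑ m ∈ Finset.Ico 1 n,
    x ^ m * y ^ n / ((m : ℂ) ^ p * (n : ℂ) ^ q)

/-- The depth-one value `Li_k(z) = ∑_{n > 0} z ^ n / n ^ k`, as the limit of the partial sums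
(the series is only conditionally convergent for `k = 1`). -/
noncomputable def li (k : ℕ) (z : ℂ) : ℂ := limUnder atTop (liPartial k z)

/-- The depth-two value `Li_{p,q}(x,y) = ∑_{0 < m < n} x ^ m y ^ n / (m ^ p n ^ q)`, as the limit
of the sums truncated at the outer variable. -/
noncomputable def liTwo (p q : ℕ) (x y : ℂ) : ℂ := limUnder atTop (liTwoPartial p q x y)

/-- The combination `(-1)^l Li_l(1/z) + Li_l(z)`. For `l = 0` it is `-1` by the convention
`Li_0(z) + Li_0(1/z) = -1`. For `l = 1`, `z = 1` the two series diverge and cancel term by term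
(`-1/n + 1/n = 0`), so that the value is `0`. -/
noncomputable def liSym (l : ℕ) (z : ℂ) : ℂ :=
  if l = 0 then -1
  else if l = 1 ∧ z = 1 then 0
  else (-1) ^ l * li l (1 / z) + li l z

/-! Sum `x^m y^n / (m^q n^k)` over nonzero integers `m < n` in `[-N, N]` and evaluate it twice.
Sorting by signs gives truncations of the two double series and of the product
(`wedgeSum_eq_liTwoPartial`). Alternatively, expand `1 / (m^q n^k)` by partial fractions in `n - m`
(`partialFraction_add`); the reflection `(m, n) ↦ (-n, -m)` brings both halves to the form `z^m
y^(n-m) / (m^l (n-m)^s)`. For fixed `m`, summing over `n` gives a truncation of `Li_s(y)` at `N -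
m`, except that the excluded `n = 0` must be subtracted when `m < 0`. The symmetric sum over `m`
then tends to `S_l(z) Li_s(y) - (-1)^l Li_{s+l}(y/z)` (`tendsto_wedgeSum_shiftTerm`). The subtracted
terms all have weight `q + k`; a hockey-stick identity adds their coefficients up to the `l = 0`
terms of the formula, which is why `S_0 = -1`. -/

/-! ### Convergence of the truncated series, with rate `O(1/N)` in depth one -/

theorem exists_tendsto_of_norm_sub_le {v : ℕ → ℂ} {c : ℝ}
    (h : ∀ N : ℕ, ‖v (N + 1) - v N‖ ≤ c * (1 / ((N : ℝ) + 1) - 1 / ((N : ℝ) + 2))) :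
    ∃ L, Tendsto v atTop (𝓝 L) ∧ ∀ N : ℕ, ‖v N - L‖ ≤ c / ((N : ℝ) + 1) := by
  have hc : 0 ≤ c := by
    have := (norm_nonneg _).trans (h 0)
    norm_num at this
    linarith
  have key : ∀ N j : ℕ, ‖v (N + j) - v N‖ ≤ c * (1 / ((N : ℝ) + 1) - 1 / ((N : ℝ) + j + 1)) := by
    intro N j
    induction j with
    | zero => simp
    | succ j ih =>
      have h1 := h (N + j)
      have h2 : v (N + (j + 1)) - v N = (v (N + j + 1) - v (N + j)) + (v (N + j) - v N) := by
        rw [← add_assoc]; ring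
      rw [h2]
      refine (norm_add_le _ _).trans ((add_le_add h1 ih).trans (le_of_eq ?_))
      push_cast
      ring
  have key2 : ∀ N j : ℕ, ‖v (N + j) - v N‖ ≤ c / ((N : ℝ) + 1) := by
    intro N j
    refine (key N j).trans ?_
    have : 0 ≤ c * (1 / ((N : ℝ) + j + 1)) := by positivity
    rw [mul_sub, mul_one_div]
    linarith
  have hlim : Tendsto (fun N : ℕ => 2 * (c / ((N : ℝ) + 1))) atTop (𝓝 0) := by
    have := (tendsto_one_div_add_atTop_nhds_zero_nat (𝕜 := ℝ)).const_mul (2 * c)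
    simp only [mul_zero] at this
    refine this.congr fun N => ?_
    ring
  have hcau : CauchySeq v := by
    refine cauchySeq_of_le_tendsto_0 _ (fun n m N hn hm => ?_) hlim
    obtain ⟨i, rfl⟩ := Nat.exists_eq_add_of_le hn
    obtain ⟨j, rfl⟩ := Nat.exists_eq_add_of_le hm
    refine (dist_triangle_right _ _ (v N)).trans ?_
    rw [dist_eq_norm, dist_eq_norm, two_mul]
    exact add_le_add (key2 N i) (key2 N j)
  obtain ⟨L, hL⟩ := cauchySeq_tendsto_of_complete hcau
  refine ⟨L, hL, fun N => ?_⟩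
  have h3 : Tendsto (fun j => ‖v N - v (j + N)‖) atTop (𝓝 ‖v N - L‖) :=
    (tendsto_const_nhds.sub ((tendsto_add_atTop_iff_nat N).2 hL)).norm
  refine le_of_tendsto h3 (Eventually.of_forall fun j => ?_)
  rw [norm_sub_rev, add_comm]
  exact key2 N j

theorem one_div_sq_le_two_mul_sub (N : ℕ) :
    1 / ((N : ℝ) + 1) ^ 2 ≤ 2 * (1 / ((N : ℝ) + 1) - 1 / ((N : ℝ) + 2)) := by
  have h : 2 * (1 / ((N : ℝ) + 1) - 1 / ((N : ℝ) + 2)) = 2 / (((N : ℝ) + 1) * ((N : ℝ) + 2)) := by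
    field_simp
    ring
  rw [h, div_le_div_iff₀ (by positivity) (by positivity)]
  nlinarith [(Nat.cast_nonneg N : (0 : ℝ) ≤ N)]

theorem liPartial_succ (k : ℕ) (z : ℂ) (N : ℕ) :
    liPartial k z (N + 1) = liPartial k z N + z ^ (N + 1) / ((N : ℂ) + 1) ^ k := by
  unfold liPartial
  rw [Finset.sum_Icc_succ_top (by omega)]
  push_cast
  rfl

theorem liTwoPartial_succ (p q : ℕ) (x y : ℂ) (N : ℕ) :
    liTwoPartial p q x y (N + 1) = liTwoPartial p q x y N +
      liPartial p x N * (y ^ (N + 1) / ((N : ℂ) + 1) ^ q) := by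
  unfold liTwoPartial liPartial
  rw [Finset.sum_Icc_succ_top (by omega), Finset.sum_mul]
  congr 1
  have : Finset.Ico 1 (N + 1) = Finset.Icc 1 N := by
    ext
    simp only [Finset.mem_Ico, Finset.mem_Icc]
    omega
  rw [this]
  refine Finset.sum_congr rfl fun m _ => ?_
  push_cast
  rw [div_mul_div_comm]

theorem norm_natCast_add_one (N : ℕ) : ‖(N : ℂ) + 1‖ = (N : ℝ) + 1 := by
  have := Complex.norm_natCast (N + 1)
  push_cast at this
  exact this

theorem norm_natCast_add_two (N : ℕ) : ‖(N : ℂ) + 2‖ = (N : ℝ) + 2 := by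
  have := Complex.norm_natCast (N + 2)
  push_cast at this
  exact this

theorem norm_pow_div_le {z : ℂ} (hz : ‖z‖ = 1) {k : ℕ} (hk : 0 < k) (N : ℕ) :
    ‖z ^ (N + 1) / ((N : ℂ) + 1) ^ k‖ ≤ 1 / ((N : ℝ) + 1) := by
  rw [norm_div, norm_pow, norm_pow, hz, norm_natCast_add_one, one_pow]
  refine one_div_le_one_div_of_le (by positivity) (le_self_pow₀ ?_ hk.ne')
  linarith [(Nat.cast_nonneg N : (0 : ℝ) ≤ N)]

/-- The explicit rate, not just convergence, is needed later: it controls double sums and cutoffs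
that depend on the summation variable. -/
theorem exists_liPartial_bound {k : ℕ} {z : ℂ} (hk : 0 < k) (hz : ‖z‖ = 1)
    (hkz : (k, z) ≠ (1, 1)) :
    ∃ L C, Tendsto (liPartial k z) atTop (𝓝 L) ∧
      ∀ N : ℕ, ‖liPartial k z N - L‖ ≤ C / ((N : ℝ) + 1) := by
  by_cases h1 : k = 1
  · subst h1
    have hz1 : 1 - z ≠ 0 := fun h => hkz (by rw [← sub_eq_zero.1 h])
    -- Boundary term of summation by parts: adding it to the partial sum leaves increments of norm
    -- `d / ((N + 1) (N + 2))`, which telescope.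
    set w : ℕ → ℂ := fun N => z ^ (N + 1) / ((1 - z) * ((N : ℂ) + 1)) with hw
    set d : ℝ := 1 / ‖1 - z‖ with hd
    have hwn : ∀ N : ℕ, ‖w N‖ = d / ((N : ℝ) + 1) := by
      intro N
      simp only [hw, norm_div, norm_mul, norm_pow, hz, norm_natCast_add_one, one_pow, hd]
      rw [div_div]
    obtain ⟨L, hL, hb⟩ := exists_tendsto_of_norm_sub_le (v := fun N => liPartial 1 z N + w N)
      (c := d) (by
        intro N
        have hN1 : (N : ℂ) + 1 ≠ 0 := Nat.cast_add_one_ne_zero N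
        have hN2 : (N : ℂ) + 2 ≠ 0 := by
          have := Nat.cast_add_one_ne_zero (R := ℂ) (N + 1)
          push_cast at this
          rwa [add_assoc, one_add_one_eq_two] at this
        have e : liPartial 1 z (N + 1) + w (N + 1) - (liPartial 1 z N + w N) =
            -(z ^ (N + 2) / ((1 - z) * (((N : ℂ) + 1) * ((N : ℂ) + 2)))) := by
          rw [liPartial_succ]
          simp only [hw]
          push_cast
          rw [show (N : ℂ) + 1 + 1 = N + 2 by ring]
          field_simp
          ring
        simp only [e]
        rw [norm_neg, norm_div, norm_mul, norm_mul, norm_pow, hz, norm_natCast_add_one,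
          norm_natCast_add_two, one_pow, ← div_div, ← hd]
        refine le_of_eq ?_
        field_simp
        ring)
    have hw0 : Tendsto w atTop (𝓝 0) := by
      rw [tendsto_zero_iff_norm_tendsto_zero]
      have := (tendsto_one_div_add_atTop_nhds_zero_nat (𝕜 := ℝ)).const_mul d
      rw [mul_zero] at this
      refine this.congr fun N => ?_
      rw [hwn, mul_one_div]
    refine ⟨L, 2 * d, ?_, fun N => ?_⟩
    · have := hL.sub hw0
      simpa using this
    · have e : liPartial 1 z N - L = (liPartial 1 z N + w N - L) - w N := by ring
      rw [e]
      refine (norm_sub_le _ _).trans ((add_le_add (hb N) (hwn N).le).trans (le_of_eq ?_))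
      ring
  · obtain ⟨L, hL, hb⟩ := exists_tendsto_of_norm_sub_le (v := liPartial k z) (c := 2) (by
      intro N
      rw [liPartial_succ, add_sub_cancel_left, norm_div, norm_pow, norm_pow, hz,
        norm_natCast_add_one, one_pow]
      refine le_trans ?_ (one_div_sq_le_two_mul_sub N)
      refine one_div_le_one_div_of_le (by positivity) (pow_le_pow_right₀ ?_ (by omega))
      linarith [(Nat.cast_nonneg N : (0 : ℝ) ≤ N)])
    exact ⟨L, 2, hL, hb⟩

theorem tendsto_liPartial {k : ℕ} {z : ℂ} (hk : 0 < k) (hz : ‖z‖ = 1) (hkz : (k, z) ≠ (1, 1)) :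
    Tendsto (liPartial k z) atTop (𝓝 (li k z)) := by
  obtain ⟨L, C, hL, -⟩ := exists_liPartial_bound hk hz hkz
  exact tendsto_nhds_limUnder ⟨L, hL⟩

theorem exists_norm_liPartial_sub_li_le {k : ℕ} {z : ℂ} (hk : 0 < k) (hz : ‖z‖ = 1)
    (hkz : (k, z) ≠ (1, 1)) :
    ∃ C : ℝ, ∀ N : ℕ, ‖liPartial k z N - li k z‖ ≤ C / ((N : ℝ) + 1) := by
  obtain ⟨L, C, hL, h⟩ := exists_liPartial_bound hk hz hkz
  rw [← tendsto_nhds_unique (tendsto_liPartial hk hz hkz) hL] at h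
  exact ⟨C, h⟩

/-- After subtracting `li p x * liPartial q y N`, each increment is a tail of size `O(1/N)` times a
term of size `O(1/N)`, hence summable even when `q = 1`. -/
theorem tendsto_liTwoPartial {p q : ℕ} {x y : ℂ} (hp : 0 < p) (hq : 0 < q) (hx : ‖x‖ = 1)
    (hy : ‖y‖ = 1) (hpx : (p, x) ≠ (1, 1)) (hqy : (q, y) ≠ (1, 1)) :
    Tendsto (liTwoPartial p q x y) atTop (𝓝 (liTwo p q x y)) := by
  obtain ⟨C, hC⟩ := exists_norm_liPartial_sub_li_le hp hx hpx
  have hC0 : 0 ≤ C := by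
    have := (norm_nonneg _).trans (hC 0)
    simpa using this
  obtain ⟨M, hM, -⟩ := exists_tendsto_of_norm_sub_le
    (v := fun N => liTwoPartial p q x y N - li p x * liPartial q y N) (c := C * 2) (by
      intro N
      rw [liTwoPartial_succ, liPartial_succ]
      have e : liTwoPartial p q x y N + liPartial p x N * (y ^ (N + 1) / ((N : ℂ) + 1) ^ q) -
          li p x * (liPartial q y N + y ^ (N + 1) / ((N : ℂ) + 1) ^ q) -
          (liTwoPartial p q x y N - li p x * liPartial q y N) =
          (liPartial p x N - li p x) * (y ^ (N + 1) / ((N : ℂ) + 1) ^ q) := by ring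
      rw [e, norm_mul, mul_assoc]
      refine (mul_le_mul (hC N) (norm_pow_div_le hy hq N) (norm_nonneg _) (by positivity)).trans ?_
      refine le_trans (le_of_eq ?_) (mul_le_mul_of_nonneg_left (one_div_sq_le_two_mul_sub N) hC0)
      rw [div_mul_div_comm, mul_one, ← pow_two, mul_one_div])
  have h := hM.add ((tendsto_liPartial hq hy hqy).const_mul (li p x))
  simp only [sub_add_cancel] at h
  exact tendsto_nhds_limUnder ⟨_, h⟩

/-! ### Partial fractions and the hockey-stick identity -/

/-- One half of the partial fraction expansion of `1 / (a ^ q * (a + r) ^ k)`. -/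
noncomputable def partialFraction (k q : ℕ) (a r : ℂ) : ℂ :=
  ∑ i ∈ Finset.range q, (-1) ^ i * (Nat.multichoose k i : ℂ) / (a ^ (q - i) * r ^ (k + i))

theorem partialFraction_succ_succ (k q : ℕ) (a : ℂ) {r : ℂ} (hr : r ≠ 0) :
    partialFraction (k + 1) (q + 1) a r =
      (partialFraction k (q + 1) a r - partialFraction (k + 1) q a r) / r := by
  unfold partialFraction
  rw [Finset.sum_range_succ', Finset.sum_range_succ', add_sub_right_comm,
    ← Finset.sum_sub_distrib, add_div, Finset.sum_div]
  congr 1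
  · refine Finset.sum_congr rfl fun i _ => ?_
    rw [Nat.multichoose_succ_succ, Nat.add_sub_add_right]
    push_cast
    by_cases ha : a ^ (q - i) = 0
    · simp [ha]
    · field_simp
      ring
  · simp only [pow_zero, Nat.multichoose_zero_right, Nat.cast_one, one_mul, Nat.sub_zero, add_zero]
    rw [div_div, mul_assoc, ← pow_succ]

theorem partialFraction_zero_left {q : ℕ} (hq : 0 < q) (a r : ℂ) :
    partialFraction 0 q a r = 1 / a ^ q := by
  obtain ⟨q, rfl⟩ := Nat.exists_eq_succ_of_ne_zero hq.ne'
  unfold partialFraction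
  rw [Finset.sum_range_succ']
  simp

/-- Both sides obey the recursion coming from `1 / (a b) = (1 / a - 1 / b) / (b - a)`; for the right
side it is Pascal's rule. When one exponent is zero, one half is an empty sum. -/
theorem partialFraction_add {a b : ℂ} (ha : a ≠ 0) (hb : b ≠ 0) (hab : b - a ≠ 0) (k q : ℕ)
    (h : 0 < k + q) :
    1 / (a ^ q * b ^ k) =
      partialFraction k q a (b - a) + partialFraction q k b (-(b - a)) := by
  induction k generalizing q with
  | zero =>
    rw [partialFraction_zero_left (by omega)]
    simp [partialFraction]
  | succ k ih =>
    induction q with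
    | zero =>
      rw [partialFraction_zero_left (by omega)]
      simp [partialFraction]
    | succ q ihq =>
      rw [partialFraction_succ_succ _ _ _ hab, partialFraction_succ_succ _ _ _ (neg_ne_zero.2 hab)]
      have h1 := ih (q + 1) (by omega)
      have h2 := ihq (by omega)
      have e : 1 / (a ^ (q + 1) * b ^ (k + 1)) =
          (1 / (a ^ (q + 1) * b ^ k) - 1 / (a ^ q * b ^ (k + 1))) / (b - a) := by
        rw [eq_div_iff hab, pow_succ, pow_succ]
        field_simp
      rw [e, h1, h2]
      field_simp
      ring

theorem sum_range_multichoose (k q : ℕ) :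
    ∑ i ∈ Finset.range (q + 1), Nat.multichoose k i = Nat.multichoose (k + 1) q := by
  induction q with
  | zero => simp
  | succ q ih => rw [Finset.sum_range_succ, ih, Nat.multichoose_succ_succ, add_comm]

/-! ### Sums over ordered pairs of nonzero integers -/

/-- The nonzero integers of absolute value at most `N`. -/
noncomputable def symmBox (N : ℕ) : Finset ℤ := (Finset.Icc (-(N : ℤ)) N).erase 0

theorem mem_symmBox {N : ℕ} {m : ℤ} : m ∈ symmBox N ↔ m ≠ 0 ∧ -(N : ℤ) ≤ m ∧ m ≤ N := by
  simp [symmBox]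

theorem sum_symmBox {M : Type*} [AddCommMonoid M] (N : ℕ) (f : ℤ → M) :
    ∑ m ∈ symmBox N, f m = ∑ i ∈ Finset.Icc 1 N, (f i + f (-(i : ℤ))) := by
  induction N with
  | zero =>
    have : symmBox 0 = ∅ := by ext m; rw [mem_symmBox]; simp; omega
    simp [this]
  | succ N ih =>
    have h : symmBox (N + 1) =
        insert ((N : ℤ) + 1) (insert (-((N : ℤ) + 1)) (symmBox N)) := by
      ext m
      simp only [Finset.mem_insert, mem_symmBox]
      push_cast
      omega
    rw [h, Finset.sum_insert, Finset.sum_insert, ih, Finset.sum_Icc_succ_top (by omega)]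
    · push_cast
      rw [← add_assoc, add_comm]
    · simp only [mem_symmBox]; omega
    · simp only [Finset.mem_insert, mem_symmBox]; omega

theorem sum_symmBox_neg {M : Type*} [AddCommMonoid M] (N : ℕ) (f : ℤ → M) :
    ∑ m ∈ symmBox N, f (-m) = ∑ m ∈ symmBox N, f m := by
  rw [sum_symmBox, sum_symmBox]
  exact Finset.sum_congr rfl fun i _ => by rw [neg_neg, add_comm]

/-- The sum of `f m n` over the nonzero integers `m < n` of absolute value at most `N`. -/
noncomputable def wedgeSum (N : ℕ) (f : ℤ → ℤ → ℂ) : ℂ :=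
  ∑ n ∈ symmBox N, ∑ m ∈ symmBox N, if m < n then f m n else 0

theorem wedgeSum_congr {N : ℕ} {f g : ℤ → ℤ → ℂ}
    (h : ∀ m n : ℤ, m ≠ 0 → n ≠ 0 → m < n → f m n = g m n) : wedgeSum N f = wedgeSum N g := by
  refine Finset.sum_congr rfl fun n hn => Finset.sum_congr rfl fun m hm => ?_
  split_ifs with hmn
  · exact h m n (mem_symmBox.1 hm).1 (mem_symmBox.1 hn).1 hmn
  · rfl

/-- The involution `(m, n) ↦ (-n, -m)` preserves both the box and the order. -/
theorem wedgeSum_neg (N : ℕ) (f : ℤ → ℤ → ℂ) :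
    wedgeSum N (fun m n => f (-n) (-m)) = wedgeSum N f := by
  unfold wedgeSum
  rw [Finset.sum_comm (s := symmBox N) (t := symmBox N) (f := fun n m => if m < n then f m n else 0),
    ← sum_symmBox_neg N fun m => ∑ n ∈ symmBox N, if m < n then f m n else 0]
  refine Finset.sum_congr rfl fun n _ => ?_
  rw [← sum_symmBox_neg N fun m => if -n < m then f (-n) m else 0]
  refine Finset.sum_congr rfl fun m _ => ?_
  simp only [neg_lt_neg_iff]

theorem wedgeSum_add (N : ℕ) (f g : ℤ → ℤ → ℂ) :
    wedgeSum N (fun m n => f m n + g m n) = wedgeSum N f + wedgeSum N g := by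
  simp only [wedgeSum, ← Finset.sum_add_distrib]
  refine Finset.sum_congr rfl fun n _ => Finset.sum_congr rfl fun m _ => ?_
  split_ifs <;> simp

theorem wedgeSum_sum {ι : Type*} (s : Finset ι) (N : ℕ) (c : ι → ℂ) (f : ι → ℤ → ℤ → ℂ) :
    wedgeSum N (fun m n => ∑ i ∈ s, c i * f i m n) = ∑ i ∈ s, c i * wedgeSum N (f i) := by
  simp only [wedgeSum, Finset.mul_sum]
  symm
  rw [Finset.sum_comm]
  refine Finset.sum_congr rfl fun n _ => ?_
  rw [Finset.sum_comm]
  refine Finset.sum_congr rfl fun m _ => ?_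
  split_ifs <;> simp

theorem sum_Icc_ite_lt {N j : ℕ} (hj : j ∈ Finset.Icc 1 N) (f : ℕ → ℂ) :
    ∑ i ∈ Finset.Icc 1 N, (if i < j then f i else 0) = ∑ i ∈ Finset.Ico 1 j, f i := by
  rw [← Finset.sum_filter]
  refine Finset.sum_congr ?_ fun _ _ => rfl
  ext i
  simp only [Finset.mem_Icc, Finset.mem_filter, Finset.mem_Ico] at hj ⊢
  omega

theorem wedgeSum_eq (N : ℕ) (f : ℤ → ℤ → ℂ) :
    wedgeSum N f = ∑ j ∈ Finset.Icc 1 N, ∑ i ∈ Finset.Ico 1 j, f i j +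
      ∑ j ∈ Finset.Icc 1 N, ∑ i ∈ Finset.Icc 1 N, f (-(i : ℤ)) j +
      ∑ j ∈ Finset.Icc 1 N, ∑ i ∈ Finset.Ico 1 j, f (-(j : ℤ)) (-(i : ℤ)) := by
  unfold wedgeSum
  rw [sum_symmBox, Finset.sum_add_distrib]
  simp only [sum_symmBox, Finset.sum_add_distrib]
  have e1 : ∑ j ∈ Finset.Icc 1 N, ∑ i ∈ Finset.Icc 1 N,
      (if (i : ℤ) < (j : ℤ) then f i j else 0) =
      ∑ j ∈ Finset.Icc 1 N, ∑ i ∈ Finset.Ico 1 j, f i j := by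
    refine Finset.sum_congr rfl fun j hj => ?_
    simp only [Nat.cast_lt]
    exact sum_Icc_ite_lt hj fun i => f i j
  have e2 : ∑ j ∈ Finset.Icc 1 N, ∑ i ∈ Finset.Icc 1 N,
      (if -(i : ℤ) < (j : ℤ) then f (-(i : ℤ)) j else 0) =
      ∑ j ∈ Finset.Icc 1 N, ∑ i ∈ Finset.Icc 1 N, f (-(i : ℤ)) j := by
    refine Finset.sum_congr rfl fun j hj => Finset.sum_congr rfl fun i hi => ?_
    rw [Finset.mem_Icc] at hi hj
    rw [if_pos (by omega)]
  have e3 : ∑ j ∈ Finset.Icc 1 N, ∑ i ∈ Finset.Icc 1 N,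
      (if (i : ℤ) < -(j : ℤ) then f i (-(j : ℤ)) else 0) = 0 := by
    refine Finset.sum_eq_zero fun j hj => Finset.sum_eq_zero fun i hi => ?_
    rw [if_neg (by omega)]
  have e4 : ∑ j ∈ Finset.Icc 1 N, ∑ i ∈ Finset.Icc 1 N,
      (if -(i : ℤ) < -(j : ℤ) then f (-(i : ℤ)) (-(j : ℤ)) else 0) =
      ∑ j ∈ Finset.Icc 1 N, ∑ i ∈ Finset.Ico 1 j, f (-(j : ℤ)) (-(i : ℤ)) := by
    rw [Finset.sum_comm]
    refine Finset.sum_congr rfl fun j hj => ?_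
    simp only [neg_lt_neg_iff, Nat.cast_lt]
    exact sum_Icc_ite_lt hj fun i => f (-(j : ℤ)) (-(i : ℤ))
  rw [e1, e2, e3, e4, zero_add]

theorem neg_one_pow_mul_self (n : ℕ) : ((-1 : ℂ) ^ n) * (-1) ^ n = 1 := by
  rw [← mul_pow]; simp

theorem div_neg_pow (a b : ℂ) (n : ℕ) : a / (-b) ^ n = (-1) ^ n * (a / b ^ n) := by
  rw [neg_pow, ← div_div, div_eq_mul_inv a, ← inv_pow, mul_comm a, mul_div_assoc]
  norm_num

theorem wedgeSum_eq_liTwoPartial (q k N : ℕ) (x y : ℂ) :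
    wedgeSum N (fun m n => x ^ m * y ^ n / ((m : ℂ) ^ q * (n : ℂ) ^ k)) =
      liTwoPartial q k x y N + (-1) ^ q * liPartial k y N * liPartial q (1 / x) N +
        (-1) ^ (q + k) * liTwoPartial k q (1 / y) (1 / x) N := by
  rw [wedgeSum_eq]
  congr 1
  · congr 1
    rw [mul_assoc, liPartial, liPartial, Finset.sum_mul_sum, Finset.mul_sum]
    simp only [Finset.mul_sum]
    refine Finset.sum_congr rfl fun j _ => Finset.sum_congr rfl fun i _ => ?_
    simp only [Int.cast_neg, Int.cast_natCast, zpow_neg, zpow_natCast, ← div_div, div_neg_pow,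
      one_div, inv_pow]
    ring
  · simp only [liTwoPartial, Finset.mul_sum]
    refine Finset.sum_congr rfl fun j _ => Finset.sum_congr rfl fun i _ => ?_
    simp only [Int.cast_neg, Int.cast_natCast, zpow_neg, zpow_natCast, ← div_div, div_neg_pow,
      one_div, inv_pow, pow_add]
    ring

/-! ### Partial fraction expansion of the sum over pairs -/

/-- The general term of the sums produced by the partial fraction expansion. -/
noncomputable def shiftTerm (l s : ℕ) (z y : ℂ) (m n : ℤ) : ℂ :=
  z ^ m * y ^ (n - m) / ((m : ℂ) ^ l * ((n : ℂ) - m) ^ s)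

theorem term_eq_sum_shiftTerm {q k : ℕ} (hq : 0 < q) {x y : ℂ} (hx : x ≠ 0)
    (hy : y ≠ 0) {m n : ℤ} (hm : m ≠ 0) (hn : n ≠ 0) (hmn : m < n) :
    x ^ m * y ^ n / ((m : ℂ) ^ q * (n : ℂ) ^ k) =
      ∑ i ∈ Finset.range q, (-1) ^ i * (Nat.multichoose k i : ℂ) *
        shiftTerm (q - i) (k + i) (x * y) y m n +
      ∑ j ∈ Finset.range k, ((-1) ^ j * (Nat.multichoose q j : ℂ) * (-1) ^ (q + k)) *
        shiftTerm (k - j) (q + j) (1 / (x * y)) (1 / x) (-n) (-m) := by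
  have hd : (n : ℂ) - m ≠ 0 := by
    rw [sub_ne_zero]
    exact_mod_cast hmn.ne'
  have h := partialFraction_add (Int.cast_ne_zero.2 hm) (Int.cast_ne_zero.2 hn) hd k q (by omega)
  rw [div_eq_mul_one_div, h, mul_add, partialFraction, partialFraction, Finset.mul_sum,
    Finset.mul_sum]
  congr 1
  · refine Finset.sum_congr rfl fun i _ => ?_
    have e : x ^ m * y ^ n = (x * y) ^ m * y ^ (n - m) := by
      rw [mul_zpow, mul_assoc, ← zpow_add₀ hy]
      congr 2
      ring
    rw [e, shiftTerm]
    ring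
  · refine Finset.sum_congr rfl fun j hj => ?_
    rw [Finset.mem_range] at hj
    have e : x ^ m * y ^ n = (1 / (x * y)) ^ (-n) * (1 / x) ^ (-m - -n) := by
      rw [one_div, one_div, inv_zpow', inv_zpow', neg_neg, mul_zpow, mul_right_comm,
        ← zpow_add₀ hx]
      congr 2
      ring
    have e2 : (((-m : ℤ) : ℂ) - ((-n : ℤ) : ℂ)) = n - m := by push_cast; ring
    have e3 : ((-n : ℤ) : ℂ) = -(n : ℂ) := by push_cast; rfl
    have e4 : ((-1 : ℂ)) ^ (q + k) = (-1) ^ (k - j) * (-1) ^ (q + j) := by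
      rw [← pow_add]; congr 1; omega
    rw [e, shiftTerm, e2, e3, e4]
    generalize (1 / (x * y)) ^ (-n) * (1 / x) ^ (-m - -n) = u
    simp only [← div_div, div_neg_pow]
    have h1 := neg_one_pow_mul_self (k - j)
    -- The sides differ only by the square of the sign `(-1) ^ (k - j)`.
    linear_combination (-(u * (-1) ^ j *
      (-1) ^ (q + j) * (Nat.multichoose q j : ℂ) / (n : ℂ) ^ (k - j) /
      ((n : ℂ) - m) ^ (q + j))) * h1

theorem wedgeSum_eq_sum_shiftTerm {q k : ℕ} (hq : 0 < q) {x y : ℂ} (hx : x ≠ 0)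
    (hy : y ≠ 0) (N : ℕ) :
    wedgeSum N (fun m n => x ^ m * y ^ n / ((m : ℂ) ^ q * (n : ℂ) ^ k)) =
      ∑ i ∈ Finset.range q, (-1) ^ i * (Nat.multichoose k i : ℂ) *
        wedgeSum N (shiftTerm (q - i) (k + i) (x * y) y) +
      ∑ j ∈ Finset.range k, ((-1) ^ j * (Nat.multichoose q j : ℂ) * (-1) ^ (q + k)) *
        wedgeSum N (shiftTerm (k - j) (q + j) (1 / (x * y)) (1 / x)) := by
  rw [wedgeSum_congr fun m n => term_eq_sum_shiftTerm hq hx hy, wedgeSum_add, wedgeSum_sum,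
    wedgeSum_sum]
  congr 1
  refine Finset.sum_congr rfl fun j _ => ?_
  rw [wedgeSum_neg]

/-! ### Limits of the expanded sums -/

theorem sum_symmBox_zpow_div_pow (l N : ℕ) (z : ℂ) :
    ∑ m ∈ symmBox N, z ^ m / (m : ℂ) ^ l =
      (-1) ^ l * liPartial l (1 / z) N + liPartial l z N := by
  rw [sum_symmBox, Finset.sum_add_distrib, add_comm]
  congr 1
  rw [liPartial, Finset.mul_sum]
  refine Finset.sum_congr rfl fun i _ => ?_
  simp only [Int.cast_neg, Int.cast_natCast, zpow_neg, zpow_natCast, div_neg_pow, one_div, inv_pow]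

theorem tendsto_sum_symmBox_zpow_div_pow {l : ℕ} (hl : 0 < l) {z : ℂ} (hz : ‖z‖ = 1) :
    Tendsto (fun N => ∑ m ∈ symmBox N, z ^ m / (m : ℂ) ^ l) atTop (𝓝 (liSym l z)) := by
  simp only [sum_symmBox_zpow_div_pow]
  unfold liSym
  rw [if_neg hl.ne']
  split_ifs with h
  -- Here every symmetric partial sum is already zero.
  · obtain ⟨rfl, rfl⟩ := h
    simp
  · have h1 : (l, z) ≠ (1, 1) := by simpa using h
    have h2 : (l, 1 / z) ≠ (1, 1) := by simpa using h
    exact ((tendsto_liPartial hl (by simp [hz]) h2).const_mul _).add (tendsto_liPartial hl hz h1)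

theorem liSym_one_div (l : ℕ) (z : ℂ) : liSym l (1 / z) = (-1) ^ l * liSym l z := by
  unfold liSym
  by_cases hl : l = 0
  · simp [hl]
  · rw [if_neg hl, if_neg hl]
    by_cases h : l = 1 ∧ z = 1
    · rw [if_pos h, if_pos (by simpa using h), mul_zero]
    · rw [if_neg h, if_neg (by simpa using h), mul_add, ← mul_assoc, neg_one_pow_mul_self,
        one_mul, one_div_one_div, add_comm]

/-- The Cesàro means of the null sequence `1 / (n + 1)` dominate these terms. -/
theorem tendsto_harmonic_div :
    Tendsto (fun N : ℕ => (1 / ((N : ℝ) + 1)) * ∑ i ∈ Finset.Icc 1 N, 1 / (i : ℝ)) atTop (𝓝 0) := by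
  have h := (tendsto_one_div_add_atTop_nhds_zero_nat (𝕜 := ℝ)).cesaro
  refine squeeze_zero (fun N => by positivity) (fun N => ?_) h
  have e : ∑ i ∈ Finset.Icc 1 N, 1 / (i : ℝ) = ∑ i ∈ Finset.range N, 1 / ((i : ℝ) + 1) := by
    refine (Finset.sum_nbij' (fun i => i + 1) (fun i => i - 1) ?_ ?_ ?_ ?_ ?_).symm <;>
      intro i hi <;> simp only [Finset.mem_range, Finset.mem_Icc] at hi ⊢
    · omega
    · omega
    · omega
    · omega
    · push_cast
      rfl
  rw [e]
  rcases Nat.eq_zero_or_pos N with rfl | hN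
  · simp
  · rw [one_div]
    have : (0 : ℝ) < N := by exact_mod_cast hN
    gcongr
    linarith

/-- The term at `-i` is at most the term at `i`, giving one factor 2. The other comes from splitting
`1 / (i (N + 1 - i))` into partial fractions, whose two pieces have equal sums under `i ↦ N + 1 -
i`. -/
theorem sum_symmBox_error_le (N : ℕ) :
    ∑ m ∈ symmBox N, 1 / |(m : ℝ)| * (1 / (((N - m).toNat : ℝ) + 1)) ≤
      4 * ((1 / ((N : ℝ) + 1)) * ∑ i ∈ Finset.Icc 1 N, 1 / (i : ℝ)) := by
  have hrefl : ∑ i ∈ Finset.Icc 1 N, 1 / ((N : ℝ) + 1 - i) = ∑ i ∈ Finset.Icc 1 N, 1 / (i : ℝ) := by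
    refine Finset.sum_nbij' (fun i => N + 1 - i) (fun i => N + 1 - i) ?_ ?_ ?_ ?_ ?_ <;>
      intro i hi <;> rw [Finset.mem_Icc] at hi
    · rw [Finset.mem_Icc]; omega
    · rw [Finset.mem_Icc]; omega
    · omega
    · omega
    · rw [Nat.cast_sub (by omega)]
      push_cast
      rfl
  have h : 4 * ((1 / ((N : ℝ) + 1)) * ∑ i ∈ Finset.Icc 1 N, 1 / (i : ℝ)) =
      ∑ i ∈ Finset.Icc 1 N, 2 * (1 / ((N : ℝ) + 1) * (1 / (i : ℝ) + 1 / ((N : ℝ) + 1 - i))) := by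
    rw [← Finset.mul_sum, ← Finset.mul_sum, Finset.sum_add_distrib, hrefl]
    ring
  rw [h, sum_symmBox]
  refine Finset.sum_le_sum fun i hi => ?_
  rw [Finset.mem_Icc] at hi
  have hi1 : (1 : ℝ) ≤ i := by exact_mod_cast hi.1
  have hi2 : (i : ℝ) ≤ N := by exact_mod_cast hi.2
  have t1 : (((N - (i : ℤ)).toNat : ℕ) : ℝ) = N - i := by
    rw [show (N - (i : ℤ)).toNat = N - i by omega, Nat.cast_sub hi.2]
  have t2 : (((N - -(i : ℤ)).toNat : ℕ) : ℝ) = N + i := by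
    rw [show (N - -(i : ℤ)).toNat = N + i by omega, Nat.cast_add]
  rw [t1, t2]
  push_cast
  rw [abs_neg, abs_of_pos (by linarith)]
  have hpos : (0 : ℝ) < N + 1 - i := by linarith
  have e : 1 / ((N : ℝ) + 1) * (1 / (i : ℝ) + 1 / ((N : ℝ) + 1 - i)) =
      1 / (i : ℝ) * (1 / ((N : ℝ) + 1 - i)) := by
    field_simp
    ring
  rw [e, two_mul, sub_add_eq_add_sub]
  gcongr
  linarith

/-- Replacing the truncation at `N - m` by its limit costs at most a constant times `∑ 1 / (|m| (N -
m + 1))`, which tends to zero although the cutoff is short for `m` near `N`. -/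
theorem tendsto_sum_symmBox_mul_liPartial {l s : ℕ} (hl : 0 < l) (hs : 0 < s) {z y : ℂ}
    (hz : ‖z‖ = 1) (hy : ‖y‖ = 1) (hsy : (s, y) ≠ (1, 1)) :
    Tendsto (fun N : ℕ => ∑ m ∈ symmBox N, z ^ m / (m : ℂ) ^ l * liPartial s y (N - m).toNat)
      atTop (𝓝 (liSym l z * li s y)) := by
  obtain ⟨C, hC⟩ := exists_norm_liPartial_sub_li_le hs hy hsy
  have h0 : Tendsto (fun N : ℕ => ∑ m ∈ symmBox N, z ^ m / (m : ℂ) ^ l *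
      (liPartial s y (N - m).toNat - li s y)) atTop (𝓝 0) := by
    have hlim := (tendsto_harmonic_div.const_mul 4).const_mul C
    rw [mul_zero, mul_zero] at hlim
    have hC0 : 0 ≤ C := by
      have := (norm_nonneg _).trans (hC 0)
      simpa using this
    refine squeeze_zero_norm (fun N => ?_) hlim
    refine (norm_sum_le _ _).trans
      (le_trans ?_ (mul_le_mul_of_nonneg_left (sum_symmBox_error_le N) hC0))
    rw [Finset.mul_sum]
    refine Finset.sum_le_sum fun m hm => ?_
    have hm1 : (1 : ℝ) ≤ |(m : ℝ)| := by
      have := Int.one_le_abs (mem_symmBox.1 hm).1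
      exact_mod_cast this
    rw [norm_mul, norm_div, norm_zpow, norm_pow, hz, one_zpow, Complex.norm_intCast,
      mul_left_comm, mul_one_div C]
    gcongr
    · exact le_self_pow₀ hm1 hl.ne'
    · exact hC _
  have := h0.add ((tendsto_sum_symmBox_zpow_div_pow hl hz).mul_const (li s y))
  rw [zero_add] at this
  refine this.congr fun N => ?_
  rw [Finset.sum_mul, ← Finset.sum_add_distrib]
  refine Finset.sum_congr rfl fun m _ => ?_
  ring

theorem sum_Ioc_shift_eq_liPartial (s N : ℕ) (y : ℂ) {m : ℤ} (hm : m ≤ N) :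
    ∑ n ∈ Finset.Ioc m N, y ^ (n - m) / ((n : ℂ) - m) ^ s = liPartial s y (N - m).toNat := by
  refine (Finset.sum_nbij' (fun i : ℕ => m + i) (fun n => (n - m).toNat) ?_ ?_ ?_ ?_ ?_).symm <;>
    intro i hi <;> simp only [Finset.mem_Ioc, Finset.mem_Icc] at hi ⊢
  · omega
  · omega
  · omega
  · omega
  · push_cast
    rw [add_sub_cancel_left, add_sub_cancel_left, zpow_natCast]

/-- Restoring `n = 0` makes the range of `n` the full interval `(m, N]`; the restored term counts
only if `m < 0`. -/
theorem sum_symmBox_shiftTerm (l s N : ℕ) (z y : ℂ) {m : ℤ} (hm : m ∈ symmBox N) :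
    ∑ n ∈ symmBox N, (if m < n then shiftTerm l s z y m n else 0) =
      z ^ m / (m : ℂ) ^ l * liPartial s y (N - m).toNat -
        if m < 0 then shiftTerm l s z y m 0 else 0 := by
  rw [mem_symmBox] at hm
  rw [← sum_Ioc_shift_eq_liPartial s N y hm.2.2, Finset.mul_sum, eq_sub_iff_add_eq, symmBox,
    Finset.sum_erase_add _ (fun n => if m < n then shiftTerm l s z y m n else 0)
      (Finset.mem_Icc.2 ⟨by omega, by omega⟩), ← Finset.sum_filter]
  refine Finset.sum_congr ?_ fun n _ => ?_
  · ext n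
    simp only [Finset.mem_filter, Finset.mem_Icc, Finset.mem_Ioc]
    omega
  · rw [shiftTerm, div_mul_div_comm]

theorem sum_symmBox_shiftTerm_zero (l s N : ℕ) (z y : ℂ) :
    ∑ m ∈ symmBox N, (if m < 0 then shiftTerm l s z y m 0 else 0) =
      (-1) ^ l * liPartial (s + l) (y / z) N := by
  rw [sum_symmBox, liPartial, Finset.mul_sum]
  refine Finset.sum_congr rfl fun i hi => ?_
  rw [Finset.mem_Icc] at hi
  rw [if_neg (by omega), if_pos (by omega), zero_add, shiftTerm]
  simp only [Int.cast_neg, Int.cast_natCast, Int.cast_zero, zero_sub, neg_neg, zpow_neg,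
    zpow_natCast, ← div_div, div_neg_pow, div_pow, pow_add]
  ring

theorem tendsto_wedgeSum_shiftTerm {l s : ℕ} (hl : 0 < l) (hs : 0 < s) {z y : ℂ}
    (hz : ‖z‖ = 1) (hy : ‖y‖ = 1) (hsy : (s, y) ≠ (1, 1)) :
    Tendsto (fun N => wedgeSum N (shiftTerm l s z y)) atTop
      (𝓝 (liSym l z * li s y - (-1) ^ l * li (s + l) (y / z))) := by
  have h1 : Tendsto (liPartial (s + l) (y / z)) atTop (𝓝 (li (s + l) (y / z))) :=
    tendsto_liPartial (by omega) (by simp [hy, hz]) (by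
      intro h
      have := (Prod.mk.inj h).1
      omega)
  refine ((tendsto_sum_symmBox_mul_liPartial hl hs hz hy hsy).sub (h1.const_mul _)).congr
    fun N => ?_
  rw [wedgeSum, Finset.sum_comm, ← sum_symmBox_shiftTerm_zero, ← Finset.sum_sub_distrib]
  exact Finset.sum_congr rfl fun m hm => (sum_symmBox_shiftTerm l s N z y hm).symm

/-! ### Binomial bookkeeping and the final identity -/

theorem IsUnityRoot.norm_eq_one {z : ℂ} (hz : IsUnityRoot z) : ‖z‖ = 1 := by
  obtain ⟨n, hn, h⟩ := hz
  exact Complex.norm_eq_one_of_pow_eq_one h hn.ne'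

theorem multichoose_eq_choose (q j : ℕ) (hq : 0 < q) :
    Nat.multichoose q j = (q + j - 1).choose (q - 1) := by
  rw [Nat.multichoose_eq]
  exact (Nat.choose_symm_of_eq_add (by omega)).symm

/-- Reindexing by `j = k - l` isolates `l = 0`, where `liSym` is `-1`. -/
theorem sum_range_choose_liSym {q k : ℕ} (hq : 0 < q) (w x : ℂ) :
    ∑ l ∈ Finset.range (k + 1),
      ((q + k - l - 1).choose (q - 1) : ℂ) * liSym l w * li (q + k - l) x =
      ∑ j ∈ Finset.range k, (Nat.multichoose q j : ℂ) * liSym (k - j) w * li (q + j) x -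
        (Nat.multichoose q k : ℂ) * li (q + k) x := by
  rw [← Finset.sum_range_reflect, Finset.sum_range_succ, sub_eq_add_neg]
  congr 1
  · refine Finset.sum_congr rfl fun j hj => ?_
    rw [Finset.mem_range] at hj
    rw [multichoose_eq_choose q j hq, show k + 1 - 1 - j = k - j by omega,
      show q + k - (k - j) = q + j by omega]
  · rw [multichoose_eq_choose q k hq]
    simp [liSym]

theorem sum_antidiagonal_choose_liSym {q k : ℕ} (hk : 0 < k) (w y : ℂ) :
    ∑ p ∈ Finset.HasAntidiagonal.antidiagonal q,
      (-1) ^ p.2 * ((p.2 + k - 1).choose (k - 1) : ℂ) * liSym p.1 w * li (k + p.2) y =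
      ∑ i ∈ Finset.range q,
        (-1) ^ i * (Nat.multichoose k i : ℂ) * liSym (q - i) w * li (k + i) y -
        (-1) ^ q * (Nat.multichoose k q : ℂ) * li (k + q) y := by
  rw [← Finset.Nat.sum_antidiagonal_swap, Finset.Nat.sum_antidiagonal_eq_sum_range_succ_mk,
    Finset.sum_range_succ, sub_eq_add_neg]
  congr 1
  · refine Finset.sum_congr rfl fun i _ => ?_
    rw [multichoose_eq_choose k i hk]
    simp only [Prod.swap_prod_mk, add_comm i k]
  · rw [multichoose_eq_choose k q hk]
    simp [liSym, add_comm q k]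

/-- Hockey stick followed by the symmetry of binomial coefficients. -/
theorem sum_range_multichoose_mul {q : ℕ} (k : ℕ) (hq : 0 < q) (hk : 0 < k) (c : ℂ) :
    ∑ i ∈ Finset.range q, (Nat.multichoose k i : ℂ) * c = Nat.multichoose q k * c := by
  rw [← Finset.sum_mul]
  congr 1
  obtain ⟨p, rfl⟩ := Nat.exists_eq_succ_of_ne_zero hq.ne'
  rw [← Nat.cast_sum, sum_range_multichoose, multichoose_eq_choose _ _ hq, Nat.multichoose_eq]
  congr 2
  simp only [Nat.succ_eq_add_one]
  omega

theorem li_two_symmetry {q k : ℕ} (hq : 0 < q) (hk : 0 < k) {x y : ℂ} (hx : ‖x‖ = 1)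
    (hy : ‖y‖ = 1) (hqx : (q, x) ≠ (1, 1)) (hky : (k, y) ≠ (1, 1)) :
    liTwo q k x y + (-1) ^ q * li k y * li q (1 / x) +
        (-1) ^ (q + k) * liTwo k q (1 / y) (1 / x) =
      (∑ i ∈ Finset.range q,
        (-1) ^ i * (Nat.multichoose k i : ℂ) * liSym (q - i) (x * y) * li (k + i) y -
        (-1) ^ q * (Nat.multichoose k q : ℂ) * li (k + q) y) +
      (-1) ^ q * (∑ j ∈ Finset.range k,
          (Nat.multichoose q j : ℂ) * liSym (k - j) (x * y) * li (q + j) (1 / x) -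
        (Nat.multichoose q k : ℂ) * li (q + k) (1 / x)) := by
  have hx0 : x ≠ 0 := fun h => by simp [h] at hx
  have hy0 : y ≠ 0 := fun h => by simp [h] at hy
  have hx' : ‖1 / x‖ = 1 := by simp [hx]
  have hy' : ‖1 / y‖ = 1 := by simp [hy]
  have hqx' : (q, 1 / x) ≠ (1, 1) := by simpa using hqx
  have hky' : (k, 1 / y) ≠ (1, 1) := by simpa using hky
  have hadd : ∀ {s : ℕ} {z : ℂ} (i : ℕ), 0 < s → (s, z) ≠ (1, 1) → (s + i, z) ≠ (1, 1) := by
    intro s z i hs h h'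
    simp only [Prod.mk.injEq] at h'
    exact h (by rw [h'.2, show s = 1 by omega])
  have hL := ((tendsto_liTwoPartial hq hk hx hy hqx hky).add
    (((tendsto_liPartial hk hy hky).const_mul ((-1) ^ q)).mul
      (tendsto_liPartial hq hx' hqx'))).add
    ((tendsto_liTwoPartial hk hq hy' hx' hky' hqx').const_mul ((-1) ^ (q + k)))
  have hR := (tendsto_finsetSum (Finset.range q) fun i hi =>
      (tendsto_wedgeSum_shiftTerm (l := q - i) (s := k + i) (z := x * y) (y := y)
        (by have := Finset.mem_range.1 hi; omega) (by omega) (by simp [hx, hy]) hy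
        (hadd i hk hky)).const_mul ((-1) ^ i * (Nat.multichoose k i : ℂ))).add
    (tendsto_finsetSum (Finset.range k) fun j hj =>
      (tendsto_wedgeSum_shiftTerm (l := k - j) (s := q + j) (z := 1 / (x * y)) (y := 1 / x)
        (by have := Finset.mem_range.1 hj; omega) (by omega) (by simp [hx, hy]) hx'
        (hadd j hq hqx')).const_mul ((-1) ^ j * (Nat.multichoose q j : ℂ) * (-1) ^ (q + k)))
  have key := tendsto_nhds_unique hL (hR.congr fun N => by
    rw [← wedgeSum_eq_sum_shiftTerm hq hx0 hy0, wedgeSum_eq_liTwoPartial])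
  -- The `n = 0` corrections cross over: those of the `range q` family, in `Li_{q+k}(1/x)`, form the
  -- `l = 0` term of the other family, and conversely.
  rw [key, ← sum_range_multichoose_mul k hq hk, mul_sub, sub_add_sub_comm]
  have s1 : ∑ i ∈ Finset.range q, (-1) ^ i * (Nat.multichoose k i : ℂ) *
      (liSym (q - i) (x * y) * li (k + i) y -
        (-1) ^ (q - i) * li (k + i + (q - i)) (y / (x * y))) =
      ∑ i ∈ Finset.range q,
        (-1) ^ i * (Nat.multichoose k i : ℂ) * liSym (q - i) (x * y) * li (k + i) y -
      (-1) ^ q * ∑ i ∈ Finset.range q, (Nat.multichoose k i : ℂ) * li (q + k) (1 / x) := by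
    rw [Finset.mul_sum, ← Finset.sum_sub_distrib]
    refine Finset.sum_congr rfl fun i hi => ?_
    rw [Finset.mem_range] at hi
    rw [show y / (x * y) = 1 / x by field_simp, show k + i + (q - i) = q + k by omega,
      show (-1 : ℂ) ^ q = (-1) ^ i * (-1) ^ (q - i) by rw [← pow_add]; congr 1; omega]
    ring
  have s2 : ∑ j ∈ Finset.range k, (-1) ^ j * (Nat.multichoose q j : ℂ) * (-1) ^ (q + k) *
      (liSym (k - j) (1 / (x * y)) * li (q + j) (1 / x) -
        (-1) ^ (k - j) * li (q + j + (k - j)) (1 / x / (1 / (x * y)))) =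
      (-1) ^ q * ∑ j ∈ Finset.range k,
        (Nat.multichoose q j : ℂ) * liSym (k - j) (x * y) * li (q + j) (1 / x) -
      (-1) ^ q * ∑ j ∈ Finset.range k, (Nat.multichoose q j : ℂ) * li (k + q) y := by
    rw [← mul_sub, ← Finset.sum_sub_distrib, Finset.mul_sum]
    refine Finset.sum_congr rfl fun j hj => ?_
    rw [Finset.mem_range] at hj
    have e : (-1 : ℂ) ^ j * (-1) ^ (q + k) * (-1) ^ (k - j) = (-1) ^ q := by
      rw [← pow_add, ← pow_add, show j + (q + k) + (k - j) = q + (k + k) by omega, pow_add,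
        pow_add _ k k, neg_one_pow_mul_self, mul_one]
    rw [show 1 / x / (1 / (x * y)) = y by field_simp, show q + j + (k - j) = k + q by omega,
      liSym_one_div, ← e]
    ring
  rw [s1, s2, sum_range_multichoose_mul q hk hq]
  ring

theorem corollary4p1 (q k : ℕ) (hq : 0 < q) (hk : 0 < k) (x y : ℂ)
    (hx : IsUnityRoot x) (hy : IsUnityRoot y)
    (hqx : (q, x) ≠ (1, 1)) (hky : (k, y) ≠ (1, 1)) :
    -- all the series involved converge
    (∀ (s : ℕ) (z : ℂ), 0 < s → IsUnityRoot z → (s, z) ≠ (1, 1) →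
      Tendsto (liPartial s z) atTop (𝓝 (li s z))) ∧
    Tendsto (liTwoPartial q k x y) atTop (𝓝 (liTwo q k x y)) ∧
    Tendsto (liTwoPartial k q (1 / y) (1 / x)) atTop (𝓝 (liTwo k q (1 / y) (1 / x))) ∧
    -- the symmetry formula
    liTwo q k x y + (-1) ^ q * li k y * li q (1 / x)
      + (-1) ^ (q + k) * liTwo k q (1 / y) (1 / x)
      - (-1) ^ q * ∑ l ∈ Finset.range (k + 1),
          ((q + k - l - 1).choose (q - 1) : ℂ) * liSym l (x * y) * li (q + k - l) (1 / x)
      - ∑ p ∈ Finset.HasAntidiagonal.antidiagonal q,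
          (-1) ^ p.2 * ((p.2 + k - 1).choose (k - 1) : ℂ) * liSym p.1 (x * y) * li (k + p.2) y
      = 0 := by 
  have hxn := hx.norm_eq_one
  have hyn := hy.norm_eq_one
  refine ⟨fun s z hs hz hsz => tendsto_liPartial hs hz.norm_eq_one hsz,
    tendsto_liTwoPartial hq hk hxn hyn hqx hky,
    tendsto_liTwoPartial hk hq (by simp [hyn]) (by simp [hxn]) (by simpa using hky)
      (by simpa using hqx), ?_⟩
  rw [li_two_symmetry hq hk hxn hyn hqx hky, sum_range_choose_liSym hq,
    sum_antidiagonal_choose_liSym hk]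
  ring
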